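/- Let $M$ be a finite set of machines and let jobs $1,\dots,n$ have weights $w_j\ge 0$. The processing time of job $j$ on machine $i$ is a random variable $P_{ij}$ with values in $\mathbb Z_{\ge 0}$ and $0<\mathbb E[P_{ij}]\le\infty$; job $j$ can be processed on machine $i$ only if $\mathbb E[P_{ij}]<\infty$ (the pair is then called eligible), and every job is eligible on at least one machine. The vectors $(P_{ij})_{i\in M}$, $j=1,\dots,n$, are independent, while for a fixed $j$ the $P_{ij}$ may be dependent. Each machine processes at most one job at a time, and a job, once started on a machine, is processed there without interruption until it is completed, at time $C_j$. Let $\Delta=\max \mathrm{Var}[P_{ij}]/\mathbb E[P_{ij}]^2$ over all eligible pairs. A non-anticipatory policy decides, over time, which job to start when and on which idle eligible machine; a decision at time $t$ may depend on all jobs, weights and distributions, and on what has been observed up to time $t$, but the realized processing time of a job becomes known only when the job completes. Let $\mathsf{OPT}$ be the infimum of $\mathbb E[\sum_j w_jC_j]$ over all non-anticipatory policies that almost surely complete all jobs. Greedy algorithm (online-list model). The jobs are presented in the order $1,\dots,n$, and each is assigned to a machine before the next one is presented. Write $k\to i$ if job $k$ has been assigned to machine $i$. Let $H(j,i)$ be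 the set of jobs $k$ with $w_k/\mathbb E[P_{ik}]>w_j/\mathbb E[P_{ij}]$, or with $w_k/\mathbb E[P_{ik}]=w_j/\mathbb E[P_{ij}]$ and $k\le j$. Job $j$ is assigned to an eligible machine $i$ that minimizes the instantaneous expected increase of the total weighted completion time, $$w_j\Bigl(\mathbb E[P_{ij}]+\sum_{k<j,\;k\to i,\;k\in H(j,i)}\mathbb E[P_{ik}]\Bigr)+\mathbb E[P_{ij}]\sum_{k<j,\;k\to i,\;k\notin H(j,i)}w_k ,$$ with ties broken arbitrarily. When all jobs have been assigned, each machine $i$ processes its jobs without idle time from time $0$ in non-increasing order of $w_j/\mathbb E[P_{ij}]$ (WSEPT order), with ties broken arbitrarily. Let $\mathsf{ALG}$ be the value of $\mathbb E[\sum_j w_jC_j]$ for this schedule. Then the greedy algorithm can always be carried out, and it is $(4+2\Delta)$-competitive: for every instance and every way to break ties, $$\mathsf{ALG}\le(4+2\Delta)\,\mathsf{OPT}.$$ -/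

import Mathlib

open scoped NNReal ENNReal

noncomputable section

namespace StochSched

/-! ### Processing times

`P i j` is the random processing time of job `j` on machine `i`; the jobs `0, 1, …, n - 1` are
presented in this order.  A job cannot be processed on a machine where its mean is infinite. -/

section Moments

variable {M : Type*} {n : ℕ} {Ω : Type*} [MeasurableSpace Ω]

/-- The expected processing time of job `j` on machine `i`. -/
def mean (μ : MeasureTheory.Measure Ω) (P : M → Fin n → Ω → ℕ) (i : M) (j : Fin n) : ℝ≥0∞ :=
  ∫⁻ ω, (P i j ω : ℝ≥0∞) ∂μ

/-- Job `j` may be processed on machine `i`. -/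
def Eligible (μ : MeasureTheory.Measure Ω) (P : M → Fin n → Ω → ℕ) (i : M) (j : Fin n) : Prop :=
  mean μ P i j ≠ ⊤

/-- The squared coefficient of variation (variance over squared mean) of an eligible pair. -/
def sqCV (μ : MeasureTheory.Measure Ω) (P : M → Fin n → Ω → ℕ) (i : M) (j : Fin n) : ℝ≥0∞ :=
  ProbabilityTheory.evariance (fun ω => (P i j ω : ℝ)) μ / mean μ P i j ^ 2

/-- `Δ`, the largest squared coefficient of variation over all eligible pairs. -/
def maxSqCV (μ : MeasureTheory.Measure Ω) (P : M → Fin n → Ω → ℕ) : ℝ≥0∞ :=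
  ⨆ (i : M) (j : Fin n) (_ : Eligible μ P i j), sqCV μ P i j

end Moments

/-! ### Non-anticipatory, non-preemptive policies

Time is continuous.  The scheduler sees the current time and, for every job, whether it is not yet
started, running (with its machine and start time), or finished (with its machine, start time and
realized processing time).  After each event (a start or a completion) the policy may plan the next
start, as a function of what it has seen so far.  The planned start takes place unless some running
job completes up to and including the planned time; in that case the completion is observed first,
and the policy plans again.  Between two events nothing random is observed except that no job has
completed, so this covers every deterministic non-anticipatory policy. -/

/-- What the scheduler knows about a job. -/
inductive JobStatus (M : Type*)
  | unstarted
  | running (i : M) (s : ℝ≥0)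
  | finished (i : M) (s : ℝ≥0) (p : ℕ)

/-- What the scheduler knows: the current time and the status of every job. -/
structure Observed (M : Type*) (n : ℕ) where
  time : ℝ≥0
  status : Fin n → JobStatus M

/-- A policy maps the observed state to its next planned start: `some (j, i, s)` means
"start job `j` on machine `i` at time `s`, unless a completion is observed before"; `none` means
"wait for the next completion". -/
abbrev Policy (M : Type*) (n : ℕ) := Observed M n → Option (Fin n × M × ℝ≥0)

section Dynamics

variable {M : Type*} {n : ℕ}

/-- At the beginning no job is started. -/
def initial (M : Type*) (n : ℕ) : Observed M n where
  time := 0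
  status := fun _ => JobStatus.unstarted

/-- The completion time of `j` if it is running (when the realized processing times are `p`). -/
def runEnd (p : M → Fin n → ℕ) (x : Observed M n) (j : Fin n) : ℝ≥0∞ :=
  match x.status j with
  | .running i s => (s : ℝ≥0∞) + (p i j : ℝ≥0∞)
  | _ => ⊤

/-- The time of the next completion, `⊤` if no job is running. -/
def nextEnd (p : M → Fin n → ℕ) (x : Observed M n) : ℝ≥0∞ := ⨅ j, runEnd p x j

/-- It is possible to start `j` on `i` at `s`: the time has not passed, `j` has not been started and
may be processed on `i`, and `i` is idle. -/
def CanStart (elig : M → Fin n → Prop) (x : Observed M n) (j : Fin n) (i : M) (s : ℝ≥0) : Prop :=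
  x.time ≤ s ∧ x.status j = JobStatus.unstarted ∧ elig i j ∧
    ∀ (k : Fin n) (t : ℝ≥0), x.status k ≠ JobStatus.running i t

/-- The event "job `j` starts on `i` at time `s`". -/
def startJob (x : Observed M n) (j : Fin n) (i : M) (s : ℝ≥0) : Observed M n where
  time := s
  status := Function.update x.status j (JobStatus.running i s)

open Classical in
/-- Wait for the next completion: all jobs that complete at that time become finished and reveal
their processing times.  Nothing changes if no job is running. -/
def waitForEnd (p : M → Fin n → ℕ) (x : Observed M n) : Observed M n where
  time := if nextEnd p x = ⊤ then x.time else (nextEnd p x).toNNReal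
  status := fun j =>
    match x.status j with
    | .running i s =>
        if (s : ℝ≥0∞) + (p i j : ℝ≥0∞) = nextEnd p x then .finished i s (p i j) else .running i s
    | st => st

open Classical in
/-- The next event, under policy `π` and realized processing times `p`. -/
def step (elig : M → Fin n → Prop) (π : Policy M n) (p : M → Fin n → ℕ) (x : Observed M n) :
    Observed M n :=
  match π x with
  | some (j, i, s) =>
      if CanStart elig x j i s ∧ (s : ℝ≥0∞) < nextEnd p x then startJob x j i s
      else waitForEnd p x
  | none => waitForEnd p x

/-- The state when no event is left: there are `n` jobs, and each event starts a job or completes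
at least one, so that there are at most `2 * n` events. -/
def finalState (elig : M → Fin n → Prop) (π : Policy M n) (p : M → Fin n → ℕ) : Observed M n :=
  (step elig π p)^[2 * n] (initial M n)

/-- The completion time of job `j` in state `x`, `⊤` if it is not finished. -/
def completionTime (x : Observed M n) (j : Fin n) : ℝ≥0∞ :=
  match x.status j with
  | .finished _ s p => (s : ℝ≥0∞) + (p : ℝ≥0∞)
  | _ => ⊤

end Dynamics

section Values

variable {M : Type*} {n : ℕ} {Ω : Type*} [MeasurableSpace Ω]

/-- The final state reached by `π` in the outcome `ω`. -/
def outcome (μ : MeasureTheory.Measure Ω) (P : M → Fin n → Ω → ℕ) (π : Policy M n) (ω : Ω) :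
    Observed M n :=
  finalState (Eligible μ P) π (fun i j => P i j ω)

/-- `π` almost surely processes all jobs. -/
def Feasible (μ : MeasureTheory.Measure Ω) (P : M → Fin n → Ω → ℕ) (π : Policy M n) : Prop :=
  ∀ᵐ ω ∂μ, ∀ j, ∃ i s p, (outcome μ P π ω).status j = JobStatus.finished i s p

/-- The expected total weighted completion time of a policy. -/
def policyCost (μ : MeasureTheory.Measure Ω) (P : M → Fin n → Ω → ℕ) (w : Fin n → ℝ≥0)
    (π : Policy M n) : ℝ≥0∞ :=
  ∫⁻ ω, ∑ j, (w j : ℝ≥0∞) * completionTime (outcome μ P π ω) j ∂μ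

/-- The optimal expected total weighted completion time of a non-anticipatory policy (which may
depend on all jobs, weights and distributions of the instance). -/
def optCost (μ : MeasureTheory.Measure Ω) (P : M → Fin n → Ω → ℕ) (w : Fin n → ℝ≥0) : ℝ≥0∞ :=
  ⨅ (π : Policy M n) (_ : Feasible μ P π), policyCost μ P w π

/-! ### The greedy algorithm -/

/-- The ratio of weight over expected processing time. -/
def ratio (μ : MeasureTheory.Measure Ω) (P : M → Fin n → Ω → ℕ) (w : Fin n → ℝ≥0)
    (i : M) (j : Fin n) : ℝ≥0∞ :=
  (w j : ℝ≥0∞) / mean μ P i j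

/-- Job `k` has at least the priority of job `j` on machine `i`: larger ratio, or equal ratio and
`k ≤ j`. -/
def Higher (μ : MeasureTheory.Measure Ω) (P : M → Fin n → Ω → ℕ) (w : Fin n → ℝ≥0)
    (i : M) (j k : Fin n) : Prop :=
  ratio μ P w i j < ratio μ P w i k ∨ (k ≤ j ∧ ratio μ P w i k = ratio μ P w i j)

open Classical in
/-- The instantaneous expected increase of the total weighted completion time if job `j` is put on
machine `i`, where the earlier jobs `k < j` have been assigned to the machines `a k`. -/
def increase (μ : MeasureTheory.Measure Ω) (P : M → Fin n → Ω → ℕ) (w : Fin n → ℝ≥0)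
    (a : Fin n → M) (j : Fin n) (i : M) : ℝ≥0∞ :=
  (w j : ℝ≥0∞) *
      (mean μ P i j +
        ∑ k with k < j ∧ a k = i ∧ Higher μ P w i j k, mean μ P i k) +
    mean μ P i j * ∑ k with k < j ∧ a k = i ∧ ¬ Higher μ P w i j k, (w k : ℝ≥0∞)

/-- The assignment `a` is a possible outcome of the greedy algorithm: every job goes to an eligible
machine that minimizes the instantaneous expected increase (ties are broken arbitrarily). -/
def IsGreedy (μ : MeasureTheory.Measure Ω) (P : M → Fin n → Ω → ℕ) (w : Fin n → ℝ≥0)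
    (a : Fin n → M) : Prop :=
  ∀ j, Eligible μ P (a j) j ∧
    ∀ i, Eligible μ P i j → increase μ P w a j (a j) ≤ increase μ P w a j i

/-- The positions `pos i` sequence the jobs assigned to machine `i` in non-increasing order of the
ratio of weight over expected processing time (ties are broken arbitrarily). -/
def IsWSEPT (μ : MeasureTheory.Measure Ω) (P : M → Fin n → Ω → ℕ) (w : Fin n → ℝ≥0)
    (a : Fin n → M) (pos : M → Equiv.Perm (Fin n)) : Prop :=
  ∀ i j k, a j = i → a k = i → pos i j < pos i k → ratio μ P w i k ≤ ratio μ P w i j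

open Classical in
/-- The completion time of `j` if each machine `i` processes the jobs assigned to it without idle
time in the order of `pos i`. -/
def listCompletion (P : M → Fin n → Ω → ℕ) (a : Fin n → M) (pos : M → Equiv.Perm (Fin n))
    (j : Fin n) (ω : Ω) : ℝ≥0∞ :=
  ∑ k with a k = a j ∧ pos (a j) k ≤ pos (a j) j, (P (a j) k ω : ℝ≥0∞)

/-- The expected total weighted completion time for an assignment and sequences. -/
def listCost (μ : MeasureTheory.Measure Ω) (P : M → Fin n → Ω → ℕ) (w : Fin n → ℝ≥0)
    (a : Fin n → M) (pos : M → Equiv.Perm (Fin n)) : ℝ≥0∞ :=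
  ∫⁻ ω, ∑ j, (w j : ℝ≥0∞) * listCompletion P a pos j ω ∂μ

end Values

end StochSched

end

/-! The proof is a dual fitting against an arbitrary feasible policy. Let α_j be the greedy increase
of job j, m_ij the mean of P_ij, and W_i(t) the weight on machine i that completes after t when the
WSEPT schedule is run with every processing time equal to its mean. A pair of jobs enters the
increase with the smaller of its two products weight times mean. It may therefore be bounded by
either product, chosen by whether the other job is complete at t. With the minimality of the greedy
choice this gives α_j ≤ w_j m_ij + w_j t + m_ij W_i(t) for every eligible i and every t
(`increase_le`).

Put t = 2u and integrate over the times u at which the policy processes j on i. The start of j is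
independent of P_ij (`indepFun_start`), and the second moment of P_ij is at most (1 + Δ) m_ij²
(`lintegral_sq_le`). Taking expectations and cancelling m_ij gives
`lintegral_startedOn_mul_increase_le`. Summed over i and j, the terms with w_j amount to at most 2 +
Δ times the cost of the policy. A machine processes one job at a time (`sum_lintegral_busy_le`), so
the terms with W_i amount to at most the sum of the integrals of W_i(2u), which is at most ALG/2
(`lintegral_openWeight_le`).

Since ALG is at most the sum of the α_j (`sum_weight_mul_expCompletion_le`), ALG ≤ (2 + Δ) cost +
ALG/2. As ALG is finite, the last term can be absorbed, which doubles the factor to 4 + 2Δ. -/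

noncomputable section

namespace StochSched

/-! ### Runs of a policy: non-anticipation and consistency of the schedule -/

section Dynamics

variable {M : Type*} {n : ℕ}

/-- The machine and the start time of a job that has been started. -/
def startData (x : Observed M n) (j : Fin n) : Option (M × ℝ≥0) :=
  match x.status j with
  | .unstarted => none
  | .running i s => some (i, s)
  | .finished i s _ => some (i, s)

lemma startData_eq_none {x : Observed M n} {j : Fin n} :
    startData x j = none ↔ x.status j = .unstarted := by
  unfold startData
  split <;> simp_all

lemma startData_of_finished {x : Observed M n} {j : Fin n} {i : M} {s : ℝ≥0} {q : ℕ}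
    (h : x.status j = .finished i s q) : startData x j = some (i, s) := by
  simp [startData, h]

lemma startData_waitForEnd (p : M → Fin n → ℕ) (x : Observed M n) (j : Fin n) :
    startData (waitForEnd p x) j = startData x j := by
  unfold startData waitForEnd
  cases h : x.status j with
  | running i s => by_cases h' : (s : ℝ≥0∞) + (p i j : ℝ≥0∞) = nextEnd p x <;> simp [h, h']
  | _ => simp [h]

lemma startData_startJob_self (x : Observed M n) (j : Fin n) (i : M) (s : ℝ≥0) :
    startData (startJob x j i s) j = some (i, s) := by
  simp [startData, startJob]

lemma startData_startJob_of_ne (x : Observed M n) {j k : Fin n} (h : k ≠ j) (i : M) (s : ℝ≥0) :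
    startData (startJob x j i s) k = startData x k := by
  simp [startData, startJob, h]

lemma step_induction {elig : M → Fin n → Prop} {π : Policy M n} {p : M → Fin n → ℕ}
    {x : Observed M n} {C : Observed M n → Prop}
    (hs : ∀ j i s, CanStart elig x j i s → (s : ℝ≥0∞) < nextEnd p x → C (startJob x j i s))
    (hw : C (waitForEnd p x)) : C (step elig π p x) := by
  unfold step
  split
  · split_ifs with h
    · exact hs _ _ _ h.1 h.2
    · exact hw
  · exact hw

/-- Starts are irrevocable: only an unstarted job can be started, and a completion keeps machine and
start time. -/
lemma startData_step_of_some {elig : M → Fin n → Prop} {π : Policy M n} {p : M → Fin n → ℕ}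
    {x : Observed M n} {j : Fin n} {v : M × ℝ≥0} (h : startData x j = some v) :
    startData (step elig π p x) j = some v := by
  refine step_induction (C := fun y => startData y j = some v) (fun k i s hc _ => ?_) ?_
  · have hk : j ≠ k := by
      rintro rfl
      rw [startData_eq_none.2 hc.2.1] at h
      cases h
    rw [startData_startJob_of_ne x hk, h]
  · rw [startData_waitForEnd, h]

section NonAnticipation

variable {p p' : M → Fin n → ℕ} {j : Fin n}

lemma runEnd_congr (hp : ∀ k, k ≠ j → ∀ i, p i k = p' i k) {x : Observed M n}
    (hx : x.status j = .unstarted) (k : Fin n) : runEnd p x k = runEnd p' x k := by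
  unfold runEnd
  by_cases hk : k = j
  · subst hk; simp [hx]
  · cases h : x.status k <;> simp [hp k hk]

/-- The dynamics read the processing times of a job only while it is running. -/
lemma step_congr (hp : ∀ k, k ≠ j → ∀ i, p i k = p' i k) (elig : M → Fin n → Prop)
    (π : Policy M n) {x : Observed M n} (hx : x.status j = .unstarted) :
    step elig π p x = step elig π p' x := by
  have hn : nextEnd p x = nextEnd p' x := iInf_congr (runEnd_congr hp hx)
  have hw : waitForEnd p x = waitForEnd p' x := by
    unfold waitForEnd
    rw [hn]
    congr 1
    funext k
    by_cases hk : k = j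
    · subst hk; simp [hx]
    · simp [hp k hk]
  unfold step
  rw [hn, hw]

/-- A policy is non-anticipatory: machine and start time of a job do not depend on its processing
times. -/
lemma startData_finalState_congr (hp : ∀ k, k ≠ j → ∀ i, p i k = p' i k)
    (elig : M → Fin n → Prop) (π : Policy M n) :
    startData (finalState elig π p) j = startData (finalState elig π p') j := by
  -- The two runs coincide until `j` is started; they may diverge afterwards, but by then the start
  -- data of `j` are fixed and equal.
  have key : ∀ m : ℕ,
      ((step elig π p)^[m] (initial M n) = (step elig π p')^[m] (initial M n)) ∨
      ∃ v, startData ((step elig π p)^[m] (initial M n)) j = some v ∧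
        startData ((step elig π p')^[m] (initial M n)) j = some v := by
    intro m
    induction m with
    | zero => exact Or.inl rfl
    | succ m ih =>
      rw [Function.iterate_succ_apply', Function.iterate_succ_apply']
      rcases ih with h | ⟨v, h, h'⟩
      · rw [← h]
        cases hd : startData ((step elig π p)^[m] (initial M n)) j with
        | none => exact Or.inl (step_congr hp elig π (startData_eq_none.1 hd))
        | some v => exact Or.inr ⟨v, startData_step_of_some hd, startData_step_of_some hd⟩
      · exact Or.inr ⟨v, startData_step_of_some h, startData_step_of_some h'⟩
  rcases key (2 * n) with h | ⟨v, h, h'⟩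
  · exact congrArg (startData · j) h
  · exact h.trans h'.symm

end NonAnticipation

/-- What holds in all states reached by a policy. -/
structure Consistent (elig : M → Fin n → Prop) (p : M → Fin n → ℕ) (x : Observed M n) : Prop where
  time_le : (x.time : ℝ≥0∞) ≤ nextEnd p x
  finished : ∀ j i s q, x.status j = .finished i s q → q = p i j ∧ s + q ≤ x.time
  eligible : ∀ j i s, startData x j = some (i, s) → elig i j
  disjoint : ∀ j k i s t, j ≠ k → startData x j = some (i, s) → startData x k = some (i, t) →
    s + p i j ≤ t ∨ t + p i k ≤ s

lemma consistent_initial (elig : M → Fin n → Prop) (p : M → Fin n → ℕ) :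
    Consistent elig p (initial M n) where
  time_le := by simp [initial]
  finished j i s q h := by cases h
  eligible j i s h := by cases h
  disjoint j k i s t _ h := by cases h

variable {elig : M → Fin n → Prop} {p : M → Fin n → ℕ} {x : Observed M n}

/-- The machine is idle, so a job started there earlier is finished, and finished jobs end no later
than the current time. -/
lemma Consistent.end_le_start (hx : Consistent elig p x) {j k : Fin n} {i : M} {s t : ℝ≥0}
    (hc : CanStart elig x j i s) (hk : startData x k = some (i, t)) : t + p i k ≤ s := by
  unfold startData at hk
  split at hk
  · cases hk
  · next i' t' h =>
    obtain ⟨rfl, rfl⟩ : i' = i ∧ t' = t := by simpa using hk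
    exact absurd h (hc.2.2.2 k t')
  · next i' t' q h =>
    obtain ⟨rfl, rfl⟩ : i' = i ∧ t' = t := by simpa using hk
    obtain ⟨rfl, h2⟩ := hx.finished k _ _ _ h
    exact h2.trans hc.1

lemma Consistent.startJob (hx : Consistent elig p x) {j : Fin n} {i : M} {s : ℝ≥0}
    (hc : CanStart elig x j i s) (hs : (s : ℝ≥0∞) < nextEnd p x) :
    Consistent elig p (startJob x j i s) where
  time_le := by
    refine le_iInf fun k => ?_
    by_cases hk : k = j
    · subst hk
      simp [runEnd, StochSched.startJob]
    · have : runEnd p (StochSched.startJob x j i s) k = runEnd p x k := by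
        simp [runEnd, StochSched.startJob, hk]
      rw [this]
      exact hs.le.trans (iInf_le _ k)
  finished k i' s' q h := by
    by_cases hk : k = j
    · subst hk
      simp [StochSched.startJob] at h
    · obtain ⟨h1, h2⟩ := hx.finished k i' s' q (by simpa [StochSched.startJob, hk] using h)
      exact ⟨h1, h2.trans hc.1⟩
  eligible k i' s' h := by
    by_cases hk : k = j
    · subst hk
      rw [startData_startJob_self] at h
      cases h
      exact hc.2.2.1
    · rw [startData_startJob_of_ne x hk] at h
      exact hx.eligible k i' s' h
  disjoint k l i' s' t' hkl hk hl := by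
    by_cases hkj : k = j
    · subst hkj
      rw [startData_startJob_self] at hk
      rw [startData_startJob_of_ne x hkl.symm] at hl
      cases hk
      exact Or.inr (hx.end_le_start hc hl)
    · rw [startData_startJob_of_ne x hkj] at hk
      by_cases hlj : l = j
      · subst hlj
        rw [startData_startJob_self] at hl
        cases hl
        exact Or.inl (hx.end_le_start hc hk)
      · rw [startData_startJob_of_ne x hlj] at hl
        exact hx.disjoint k l i' s' t' hkl hk hl

lemma time_waitForEnd (p : M → Fin n → ℕ) (x : Observed M n) :
    (nextEnd p x = ⊤ ∧ (waitForEnd p x).time = x.time) ∨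
      ((waitForEnd p x).time : ℝ≥0∞) = nextEnd p x := by
  by_cases h : nextEnd p x = ⊤
  · exact Or.inl ⟨h, by simp [waitForEnd, h]⟩
  · exact Or.inr (by simp [waitForEnd, h])

/-- Waiting only moves the end of some running jobs to `⊤`; all other ends stay as they were. -/
lemma nextEnd_le_nextEnd_waitForEnd (p : M → Fin n → ℕ) (x : Observed M n) :
    nextEnd p x ≤ nextEnd p (waitForEnd p x) := by
  refine le_iInf fun k => ?_
  have hk : nextEnd p x ≤ runEnd p x k := iInf_le _ k
  unfold runEnd at hk ⊢
  cases h : x.status k with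
  | running i s =>
    rw [h] at hk
    by_cases h' : (s : ℝ≥0∞) + (p i k : ℝ≥0∞) = nextEnd p x
    · simp [waitForEnd, h, h']
    · simpa [waitForEnd, h, h'] using hk
  | _ => simp [waitForEnd, h]

lemma Consistent.waitForEnd (hx : Consistent elig p x) :
    Consistent elig p (waitForEnd p x) where
  time_le := by
    rcases time_waitForEnd p x with ⟨h, h'⟩ | h
    · exact le_top.trans (h ▸ nextEnd_le_nextEnd_waitForEnd p x)
    · exact h ▸ nextEnd_le_nextEnd_waitForEnd p x
  finished k i s q h := by
    have hmono : x.time ≤ (StochSched.waitForEnd p x).time := by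
      rcases time_waitForEnd p x with ⟨_, h'⟩ | h'
      · exact h'.ge
      · exact ENNReal.coe_le_coe.1 (h' ▸ hx.time_le)
    cases hs : x.status k with
    | unstarted => simp [StochSched.waitForEnd, hs] at h
    | finished i' s' q' =>
      obtain ⟨h1, h2⟩ := hx.finished k i s q (by simpa [StochSched.waitForEnd, hs] using h)
      exact ⟨h1, h2.trans hmono⟩
    | running i' s' =>
      by_cases h' : (s' : ℝ≥0∞) + (p i' k : ℝ≥0∞) = nextEnd p x
      · simp only [StochSched.waitForEnd, hs, h', if_true, JobStatus.finished.injEq] at h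
        obtain ⟨rfl, rfl, rfl⟩ := h
        refine ⟨rfl, ?_⟩
        -- A job that just completed has a finite end, so `nextEnd` cannot be `⊤`.
        rcases time_waitForEnd p x with ⟨h1, _⟩ | h1
        · rw [h1] at h'
          exact absurd h' (by simp)
        · rw [← h1] at h'
          exact_mod_cast h'.le
      · simp [StochSched.waitForEnd, hs, h'] at h
  eligible k i s h := hx.eligible k i s (by rwa [startData_waitForEnd] at h)
  disjoint j k i s t hjk hj hk := by
    rw [startData_waitForEnd] at hj hk
    exact hx.disjoint j k i s t hjk hj hk

lemma consistent_finalState (elig : M → Fin n → Prop) (π : Policy M n) (p : M → Fin n → ℕ) :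
    Consistent elig p (finalState elig π p) := by
  unfold finalState
  generalize 2 * n = m
  induction m with
  | zero => exact consistent_initial elig p
  | succ m ih =>
    rw [Function.iterate_succ_apply']
    exact step_induction (fun j i s hc hs => ih.startJob hc hs) ih.waitForEnd

end Dynamics

end StochSched

namespace StochSched

open MeasureTheory

/-! ### The greedy assignment, its dual feasibility and its cost -/

section Greedy

variable {M : Type*} {n : ℕ} {Ω : Type*} [MeasurableSpace Ω] {μ : Measure Ω}
  {P : M → Fin n → Ω → ℕ} {w : Fin n → ℝ≥0} {a a' : Fin n → M}

lemma increase_congr {j : Fin n} (h : ∀ k < j, a k = a' k) (i : M) :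
    increase μ P w a j i = increase μ P w a' j i := by
  classical
  have e : ∀ Q : Fin n → Prop, ∀ k, (k < j ∧ a k = i ∧ Q k) ↔ (k < j ∧ a' k = i ∧ Q k) :=
    fun Q k => and_congr_right fun hk => by rw [h k hk]
  unfold increase
  simp only [e (Higher μ P w i j), e fun k => ¬ Higher μ P w i j k]

lemma exists_isGreedy [Finite M] (helig : ∀ j, ∃ i, Eligible μ P i j) (w : Fin n → ℝ≥0) :
    ∃ a, IsGreedy μ P w a := by
  classical
  choose d hd using helig
  have hmin : ∀ (b : Fin n → M) (j : Fin n), ∃ i, Eligible μ P i j ∧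
      ∀ i', Eligible μ P i' j → increase μ P w b j i ≤ increase μ P w b j i' := fun b j => by
    obtain ⟨i, hi, h⟩ := Set.exists_min_image {i | Eligible μ P i j} (increase μ P w b j)
      (Set.toFinite _) ⟨d j, hd j⟩
    exact ⟨i, hi, h⟩
  choose g hg using hmin
  -- Jobs not yet presented get the dummy machine `d k`; by `increase_congr` this does not affect
  -- the increase of `j`.
  let F : (j : Fin n) → ((k : Fin n) → k < j → M) → M := fun j r =>
    g (fun k => if h : k < j then r k h else d k) j
  let a : Fin n → M := IsWellFounded.fix (· < ·) F
  have ha : ∀ j, a j = g (fun k => if k < j then a k else d k) j := fun j => by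
    have := IsWellFounded.fix_eq (· < ·) F j
    simpa [F, a] using this
  refine ⟨a, fun j => ?_⟩
  have hc : ∀ i, increase μ P w a j i =
      increase μ P w (fun k => if k < j then a k else d k) j i :=
    increase_congr fun k hk => by simp [hk]
  rw [ha j]
  refine ⟨(hg _ j).1, fun i hi => ?_⟩
  rw [hc, hc]
  exact (hg _ j).2 i hi

lemma exists_isWSEPT (μ : Measure Ω) (P : M → Fin n → Ω → ℕ) (w : Fin n → ℝ≥0)
    (a : Fin n → M) : ∃ pos, IsWSEPT μ P w a pos := by
  -- `Tuple.sort` maps positions to jobs, hence the inverse; the order dual makes the ratios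
  -- non-increasing.
  refine ⟨fun i => (Tuple.sort fun j => OrderDual.toDual (ratio μ P w i j))⁻¹,
    fun i j k _ _ h => ?_⟩
  have := Tuple.monotone_sort (fun j => OrderDual.toDual (ratio μ P w i j)) h.le
  simpa using this

/-- If `j` has at most the ratio of `k` on `i`, then putting `k` first is best for the pair. -/
lemma weight_mul_mean_le {i : M} {j k : Fin n} (hpos : ∀ i j, 0 < mean μ P i j)
    (hj : Eligible μ P i j) (hk : Eligible μ P i k) (h : ratio μ P w i j ≤ ratio μ P w i k) :
    w j * mean μ P i k ≤ mean μ P i j * w k := by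
  unfold ratio at h
  rw [ENNReal.div_le_iff (hpos i j).ne' hj] at h
  calc (w j : ℝ≥0∞) * mean μ P i k
      ≤ (w k / mean μ P i k * mean μ P i j) * mean μ P i k := by gcongr
    _ = (w k / mean μ P i k * mean μ P i k) * mean μ P i j := by ring
    _ = mean μ P i j * w k := by
      rw [ENNReal.div_mul_cancel (hpos i k).ne' hk, mul_comm]

open Classical in
lemma increase_eq (a : Fin n → M) (j : Fin n) (i : M) :
    increase μ P w a j i = w j * mean μ P i j +
      ∑ k with k < j ∧ a k = i,
        if Higher μ P w i j k then w j * mean μ P i k else mean μ P i j * w k := by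
  rw [Finset.sum_ite, Finset.filter_filter, Finset.filter_filter]
  simp only [increase, mul_add, Finset.mul_sum, and_assoc, add_assoc]

lemma Higher.ratio_le {i : M} {j k : Fin n} (h : Higher μ P w i j k) :
    ratio μ P w i j ≤ ratio μ P w i k :=
  h.elim le_of_lt fun h => h.2.ge

lemma ratio_le_of_not_higher {i : M} {j k : Fin n} (h : ¬ Higher μ P w i j k) :
    ratio μ P w i k ≤ ratio μ P w i j :=
  not_lt.1 fun h' => h (Or.inl h')

open Classical in
/-- The contribution of a pair to the increase is that of the cheaper order of the pair. -/
lemma pair_increase_eq_min (hpos : ∀ i j, 0 < mean μ P i j) {i : M} {j k : Fin n}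
    (hj : Eligible μ P i j) (hk : Eligible μ P i k) :
    (if Higher μ P w i j k then (w j : ℝ≥0∞) * mean μ P i k else mean μ P i j * w k) =
      min (w j * mean μ P i k) (mean μ P i j * w k) := by
  split_ifs with h
  · exact (min_eq_left (weight_mul_mean_le hpos hj hk h.ratio_le)).symm
  · refine (min_eq_right ?_).symm
    rw [mul_comm (mean μ P i j), mul_comm (w j : ℝ≥0∞)]
    exact weight_mul_mean_le hpos hk hj (ratio_le_of_not_higher h)

open Classical in
-- The minimum is symmetric in the pair and no longer mentions priorities, so the tie-breaking in
-- `Higher` becomes irrelevant.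
lemma increase_eq_min (hpos : ∀ i j, 0 < mean μ P i j) (ha : ∀ j, Eligible μ P (a j) j)
    {j : Fin n} {i : M} (hj : Eligible μ P i j) :
    increase μ P w a j i = w j * mean μ P i j +
      ∑ k with k < j ∧ a k = i, min (w j * mean μ P i k) (mean μ P i j * w k) := by
  rw [increase_eq]
  congr 1
  refine Finset.sum_congr rfl fun k hk => pair_increase_eq_min hpos hj ?_
  rw [← (Finset.mem_filter.1 hk).2.2]
  exact ha k

open Classical in
/-- The completion time of `k` if all processing times equal their expectations. -/
def expCompletion (μ : Measure Ω) (P : M → Fin n → Ω → ℕ) (a : Fin n → M)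
    (pos : M → Equiv.Perm (Fin n)) (j : Fin n) : ℝ≥0∞ :=
  ∑ k with a k = a j ∧ pos (a j) k ≤ pos (a j) j, mean μ P (a j) k

open Classical in
/-- The total weight of the jobs assigned to `i` with expected completion time after `t`. -/
def openWeight (μ : Measure Ω) (P : M → Fin n → Ω → ℕ) (w : Fin n → ℝ≥0) (a : Fin n → M)
    (pos : M → Equiv.Perm (Fin n)) (i : M) (t : ℝ≥0∞) : ℝ≥0∞ :=
  ∑ k with a k = i, if t < expCompletion μ P a pos k then (w k : ℝ≥0∞) else 0

variable {pos : M → Equiv.Perm (Fin n)}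

open Classical in
-- All jobs complete at `t` precede or equal the last of them in the sequence of `i`, so their means
-- are part of the expected completion time of that job, which is at most `t`.
lemma sum_mean_completed_le (i : M) (t : ℝ≥0∞) :
    (∑ k with a k = i ∧ ¬ t < expCompletion μ P a pos k, mean μ P i k) ≤ t := by
  rcases (Finset.univ.filter fun k => a k = i ∧ ¬ t < expCompletion μ P a pos k).eq_empty_or_nonempty
    with h | h
  · rw [h]
    simp
  · obtain ⟨l, hl, hmax⟩ := Finset.exists_max_image _ (pos i) h
    obtain ⟨rfl, hlt⟩ : a l = i ∧ ¬ t < expCompletion μ P a pos l := by simpa using hl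
    refine le_trans (Finset.sum_le_sum_of_subset fun k hk => ?_) (not_lt.1 hlt)
    rw [Finset.mem_filter] at hk ⊢
    exact ⟨hk.1, hk.2.1, hmax k (by simpa using hk.2)⟩

/-- The dual feasibility of the greedy assignment. -/
lemma increase_le (hpos : ∀ i j, 0 < mean μ P i j) (ha : ∀ j, Eligible μ P (a j) j)
    {j : Fin n} {i : M} (hj : Eligible μ P i j) (t : ℝ≥0∞) :
    increase μ P w a j i ≤
      w j * mean μ P i j + w j * t + mean μ P i j * openWeight μ P w a pos i t := by
  classical
  -- The minimum is bounded by the product that suits the state of `k` at `t`. Dropping `k < j` only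
  -- adds terms and makes the weight on the right independent of `j`.
  have h1 : ∑ k with k < j ∧ a k = i, min (w j * mean μ P i k) (mean μ P i j * w k) ≤
      ∑ k with a k = i, if t < expCompletion μ P a pos k then mean μ P i j * w k
        else w j * mean μ P i k := by
    refine (Finset.sum_le_sum_of_subset fun k hk => ?_).trans (Finset.sum_le_sum fun k _ => ?_)
    · simp only [Finset.mem_filter] at hk ⊢
      exact ⟨hk.1, hk.2.2⟩
    · split_ifs
      · exact min_le_right _ _
      · exact min_le_left _ _
  have h2 : (∑ k with a k = i, if t < expCompletion μ P a pos k then mean μ P i j * w k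
        else w j * mean μ P i k) ≤
      w j * t + mean μ P i j * openWeight μ P w a pos i t := by
    rw [Finset.sum_ite, add_comm, Finset.filter_filter, Finset.filter_filter, ← Finset.mul_sum,
      ← Finset.mul_sum]
    refine add_le_add (mul_le_mul_right (sum_mean_completed_le i t) _) (le_of_eq ?_)
    rw [openWeight, ← Finset.sum_filter, Finset.filter_filter]
  rw [increase_eq_min hpos ha hj, add_assoc]
  exact add_le_add_right (h1.trans h2) _

lemma listCost_eq (hmeas : ∀ i j, Measurable (P i j)) :
    listCost μ P w a pos = ∑ j, w j * expCompletion μ P a pos j := by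
  have hm : ∀ i k, Measurable fun ω => (P i k ω : ℝ≥0∞) := fun i k =>
    Measurable.of_discrete.comp (hmeas i k)
  have hs : ∀ i (s : Finset (Fin n)), Measurable fun ω => ∑ k ∈ s, (P i k ω : ℝ≥0∞) :=
    fun i s => Finset.measurable_sum s fun k _ => hm i k
  have hl : ∀ j, Measurable (listCompletion P a pos j) := fun j => hs (a j) _
  unfold listCost
  rw [lintegral_finsetSum _ fun j _ => (hl j).const_mul _]
  refine Finset.sum_congr rfl fun j _ => ?_
  rw [lintegral_const_mul _ (hl j)]
  exact congrArg _ (lintegral_finsetSum _ fun k _ => hm (a j) k)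

lemma expCompletion_ne_top (ha : ∀ j, Eligible μ P (a j) j) (j : Fin n) :
    expCompletion μ P a pos j ≠ ⊤ := by
  classical
  refine ENNReal.sum_ne_top.2 fun k hk => ?_
  rw [← (Finset.mem_filter.1 hk).2.1]
  exact ha k

lemma listCost_ne_top (hmeas : ∀ i j, Measurable (P i j)) (ha : ∀ j, Eligible μ P (a j) j) :
    listCost μ P w a pos ≠ ⊤ := by
  rw [listCost_eq hmeas]
  exact ENNReal.sum_ne_top.2 fun j _ => ENNReal.mul_ne_top (by simp) (expCompletion_ne_top ha j)

/-- A double sum without diagonal, sorted by the larger index. -/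
lemma sum_sum_eq_sum_lt {n : ℕ} (f : Fin n → Fin n → ℝ≥0∞) (hf : ∀ j, f j j = 0) :
    ∑ j, ∑ k, f j k = ∑ j, ∑ k with k < j, (f j k + f k j) := by
  have h : ∀ j k, f j k = (if k < j then f j k else 0) + if j < k then f j k else 0 := by
    intro j k
    rcases lt_trichotomy j k with h | rfl | h
    · simp [h, h.not_gt]
    · simp [hf]
    · simp [h, h.not_gt]
  have h' : ∑ j, ∑ k, (if j < k then f j k else 0) = ∑ j, ∑ k, if k < j then f k j else 0 :=
    Finset.sum_comm
  calc ∑ j, ∑ k, f j k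
      = ∑ j, ∑ k, ((if k < j then f j k else 0) + if j < k then f j k else 0) :=
        Finset.sum_congr rfl fun j _ => Finset.sum_congr rfl fun k _ => h j k
    _ = ∑ j, ∑ k with k < j, (f j k + f k j) := by
        simp only [Finset.sum_add_distrib, h', Finset.sum_filter]

/-- The WSEPT schedule costs at most the sum of the expected increases. -/
lemma sum_weight_mul_expCompletion_le (hpos : ∀ i j, 0 < mean μ P i j)
    (ha : ∀ j, Eligible μ P (a j) j) (hp : IsWSEPT μ P w a pos) :
    ∑ j, w j * expCompletion μ P a pos j ≤ ∑ j, increase μ P w a j (a j) := by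
  classical
  -- `f j k` is the weighted delay that `k` causes to `j`.
  let f : Fin n → Fin n → ℝ≥0∞ := fun j k =>
    if a k = a j ∧ pos (a j) k < pos (a j) j then w j * mean μ P (a j) k else 0
  have hc : ∀ j, (w j : ℝ≥0∞) * expCompletion μ P a pos j =
      w j * mean μ P (a j) j + ∑ k, f j k := by
    intro j
    have hs : (Finset.univ.filter fun k => a k = a j ∧ pos (a j) k ≤ pos (a j) j) =
        insert j (Finset.univ.filter fun k => a k = a j ∧ pos (a j) k < pos (a j) j) := by
      ext k
      simp only [Finset.mem_filter, Finset.mem_univ, true_and, Finset.mem_insert, le_iff_lt_or_eq,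
        EmbeddingLike.apply_eq_iff_eq]
      constructor
      · rintro ⟨h, h' | h'⟩
        · exact Or.inr ⟨h, h'⟩
        · exact Or.inl h'
      · rintro (rfl | ⟨h, h'⟩)
        · exact ⟨rfl, Or.inr rfl⟩
        · exact ⟨h, Or.inl h'⟩
    rw [expCompletion, hs, Finset.sum_insert (by simp), mul_add, Finset.mul_sum,
      Finset.sum_filter]
  have hi : ∀ j, increase μ P w a j (a j) = w j * mean μ P (a j) j + ∑ k with k < j,
      if a k = a j then min (w j * mean μ P (a j) k) (mean μ P (a j) j * w k) else 0 := by
    intro j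
    rw [increase_eq_min hpos ha (ha j), ← Finset.sum_filter, Finset.filter_filter]
  simp only [hc, hi, Finset.sum_add_distrib]
  rw [sum_sum_eq_sum_lt f fun j => by simp [f]]
  gcongr with j _ k hk
  have hkj : k ≠ j := (Finset.mem_filter.1 hk).2.ne
  by_cases h : a k = a j
  · have hek : Eligible μ P (a j) k := h ▸ ha k
    -- Only the later job of the pair is delayed. By WSEPT the earlier one has at least its ratio,
    -- so the delay is the smaller of the two products.
    rcases lt_or_gt_of_ne fun h' => hkj ((pos (a j)).injective h') with h' | h'
    · have := weight_mul_mean_le hpos (ha j) hek (hp (a j) k j h rfl h')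
      simp [f, h, h', h'.not_gt, this]
    · have := weight_mul_mean_le hpos hek (ha j) (hp (a j) j k rfl h h')
      rw [mul_comm (mean μ P (a j) k), mul_comm (w k : ℝ≥0∞)] at this
      simp [f, h, h', h'.not_gt, this, mul_comm (w k : ℝ≥0∞)]
  · simp [f, h, Ne.symm h]

section Integral

lemma measurable_openWeight (i : M) : Measurable (openWeight μ P w a pos i) := by
  classical
  exact Finset.measurable_sum _ fun k _ =>
    Measurable.ite measurableSet_Iio measurable_const measurable_const

/-- A job with expected completion time c is open at time 2u exactly for u < c/2. Running the dual
at double speed thus produces the factor 1/2 that is later absorbed. -/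
lemma lintegral_openWeight_le [Fintype M] (ha : ∀ j, Eligible μ P (a j) j) :
    ∑ i, ∫⁻ u in Set.Ici (0 : ℝ), openWeight μ P w a pos i (ENNReal.ofReal (2 * u)) ≤
      (∑ j, w j * expCompletion μ P a pos j) / 2 := by
  classical
  have hjob : ∀ k, ∫⁻ u in Set.Ici (0 : ℝ),
      (if ENNReal.ofReal (2 * u) < expCompletion μ P a pos k then (w k : ℝ≥0∞) else 0) ≤
        w k * expCompletion μ P a pos k / 2 := by
    intro k
    set c := expCompletion μ P a pos k with hc
    have hct : c ≠ ⊤ := expCompletion_ne_top ha k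
    calc ∫⁻ u in Set.Ici (0 : ℝ), (if ENNReal.ofReal (2 * u) < c then (w k : ℝ≥0∞) else 0)
        ≤ ∫⁻ u in Set.Ici (0 : ℝ), (Set.Iio (c.toReal / 2)).indicator (fun _ => (w k : ℝ≥0∞)) u := by
          refine lintegral_mono fun u => ?_
          by_cases h : ENNReal.ofReal (2 * u) < c
          · have : u < c.toReal / 2 := by
              have := (ENNReal.ofReal_lt_ofReal_iff'.1 (h.trans_eq (ENNReal.ofReal_toReal hct).symm)).1
              linarith
            rw [if_pos h, Set.indicator_of_mem (Set.mem_Iio.2 this)]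
          · rw [if_neg h]
            exact zero_le
      _ = w k * c / 2 := by
          rw [lintegral_indicator_const measurableSet_Iio,
            Measure.restrict_apply measurableSet_Iio, Set.Iio_inter_Ici, Real.volume_Ico, sub_zero,
            ENNReal.ofReal_div_of_pos two_pos, ENNReal.ofReal_toReal hct, mul_div_assoc]
          simp
  have hm : Measurable fun u : ℝ => ENNReal.ofReal (2 * u) := by fun_prop
  calc ∑ i, ∫⁻ u in Set.Ici (0 : ℝ), openWeight μ P w a pos i (ENNReal.ofReal (2 * u))
      = ∑ i, ∑ k with a k = i, ∫⁻ u in Set.Ici (0 : ℝ),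
          (if ENNReal.ofReal (2 * u) < expCompletion μ P a pos k then (w k : ℝ≥0∞) else 0) := by
        refine Finset.sum_congr rfl fun i _ => ?_
        unfold openWeight
        exact lintegral_finsetSum _ fun k _ => Measurable.ite
          (measurableSet_lt hm measurable_const) measurable_const measurable_const
    _ = ∑ k, ∫⁻ u in Set.Ici (0 : ℝ),
          (if ENNReal.ofReal (2 * u) < expCompletion μ P a pos k then (w k : ℝ≥0∞) else 0) :=
        Finset.sum_fiberwise _ _ _
    _ ≤ ∑ k, w k * expCompletion μ P a pos k / 2 := Finset.sum_le_sum fun k _ => hjob k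
    _ = (∑ j, w j * expCompletion μ P a pos j) / 2 := by
        simp only [div_eq_mul_inv, Finset.sum_mul]

end Integral

end Greedy

end StochSched

namespace StochSched

open MeasureTheory ProbabilityTheory

/-! ### Processing intervals, independence of starts, second moments -/

section Policies

variable {M : Type*} {n : ℕ} {Ω : Type*} [MeasurableSpace Ω] {μ : Measure Ω}
  {P : M → Fin n → Ω → ℕ} {w : Fin n → ℝ≥0}

/-- Whether a job with start data `v` has been started on `i`. -/
def startedOn (i : M) (v : Option (M × ℝ≥0)) : ℝ≥0∞ :=
  open Classical in v.elim 0 fun y => if y.1 = i then 1 else 0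

/-- The start time of a job with start data `v` if it has been started on `i`, and `0` otherwise. -/
def startOn (i : M) (v : Option (M × ℝ≥0)) : ℝ≥0∞ :=
  open Classical in v.elim 0 fun y => if y.1 = i then (y.2 : ℝ≥0∞) else 0

/-- The times at which a job with start data `v` and processing time `q` is processed on `i`. -/
def busy (i : M) (v : Option (M × ℝ≥0)) (q : ℕ) : Set ℝ :=
  {u | ∃ s, v = some (i, s) ∧ u ∈ Set.Ico (s : ℝ) (s + q)}

lemma busy_some (i : M) (s : ℝ≥0) (q : ℕ) : busy i (some (i, s)) q = Set.Ico (s : ℝ) (s + q) := by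
  ext u
  simp [busy]

lemma busy_of_ne {i : M} {v : Option (M × ℝ≥0)} (h : ∀ s, v ≠ some (i, s)) (q : ℕ) :
    busy i v q = ∅ := by
  ext u
  simp [busy, h]

lemma startedOn_of_ne {i : M} {v : Option (M × ℝ≥0)} (h : ∀ s, v ≠ some (i, s)) :
    startedOn i v = 0 := by
  rcases v with _ | ⟨i', s⟩
  · rfl
  · have : i' ≠ i := fun h' => h s (by rw [h'])
    simp [startedOn, this]

lemma startedOn_some (i : M) (s : ℝ≥0) : startedOn i (some (i, s)) = 1 := by simp [startedOn]

lemma startOn_some (i : M) (s : ℝ≥0) : startOn i (some (i, s)) = s := by simp [startOn]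

lemma measurableSet_busy (i : M) (v : Option (M × ℝ≥0)) (q : ℕ) : MeasurableSet (busy i v q) := by
  by_cases h : ∃ s, v = some (i, s)
  · obtain ⟨s, rfl⟩ := h
    rw [busy_some]
    exact measurableSet_Ico
  · rw [busy_of_ne fun s hs => h ⟨s, hs⟩]
    exact MeasurableSet.empty

lemma busy_subset (i : M) (v : Option (M × ℝ≥0)) (q : ℕ) : busy i v q ⊆ Set.Ici 0 := by
  rintro u ⟨s, -, hu⟩
  exact s.coe_nonneg.trans hu.1

lemma lintegral_Ico_two_mul (s : ℝ≥0) (q : ℕ) :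
    ∫⁻ u in Set.Ico (s : ℝ) (s + q), ENNReal.ofReal (2 * u) = 2 * s * q + (q : ℝ≥0∞) ^ 2 := by
  have hsq : (s : ℝ) ≤ s + q := by simp
  rw [← ofReal_integral_eq_lintegral_ofReal, integral_Ico_eq_integral_Ioc,
    ← intervalIntegral.integral_of_le hsq, intervalIntegral.integral_const_mul, integral_id]
  · have : 2 * (((s + q : ℝ) ^ 2 - (s : ℝ) ^ 2) / 2) = ((2 * s * q + (q : ℝ≥0) ^ 2 : ℝ≥0) : ℝ) := by
      push_cast
      ring
    rw [this, ENNReal.ofReal_coe_nnreal]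
    push_cast
    rfl
  · exact (Continuous.integrableOn_Icc (by fun_prop)).mono_set Set.Ico_subset_Icc_self
  · refine (ae_restrict_iff' measurableSet_Ico).2 (ae_of_all _ fun u hu => ?_)
    have := s.coe_nonneg.trans hu.1
    simp only [Pi.zero_apply]
    positivity

/-- A pointwise bound that is affine in time, integrated over the processing of a job. -/
lemma startedOn_mul_le {i : M} {v : Option (M × ℝ≥0)} {q : ℕ} {α c b m : ℝ≥0∞}
    {β : ℝ → ℝ≥0∞} (hβ : Measurable β)
    (h : ∀ u, α ≤ c + b * ENNReal.ofReal (2 * u) + m * β u) :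
    startedOn i v * q * α ≤ b * (2 * (startOn i v * q) + startedOn i v * (q : ℝ≥0∞) ^ 2) +
      c * (startedOn i v * q) + m * ∫⁻ u in busy i v q, β u := by
  by_cases hv : ∃ s, v = some (i, s)
  · obtain ⟨s, rfl⟩ := hv
    have hvol : volume (Set.Ico (s : ℝ) (s + q)) = q := by simp
    rw [busy_some, startedOn_some, startOn_some]
    calc 1 * (q : ℝ≥0∞) * α = ∫⁻ _ in Set.Ico (s : ℝ) (s + q), α := by
          rw [setLIntegral_const, hvol, one_mul, mul_comm]
      _ ≤ ∫⁻ u in Set.Ico (s : ℝ) (s + q), (c + b * ENNReal.ofReal (2 * u) + m * β u) :=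
          lintegral_mono h
      _ = c * q + b * (2 * s * q + (q : ℝ≥0∞) ^ 2) +
            m * ∫⁻ u in Set.Ico (s : ℝ) (s + q), β u := by
          rw [lintegral_add_right _ (by fun_prop), lintegral_add_left (by fun_prop),
            lintegral_const_mul _ (by fun_prop), lintegral_const_mul _ hβ, setLIntegral_const, hvol,
            lintegral_Ico_two_mul]
      _ = _ := by ring
  · have hv' : ∀ s, v ≠ some (i, s) := fun s hs => hv ⟨s, hs⟩
    simp [startedOn_of_ne hv']

lemma sum_startedOn [Fintype M] (i : M) (s : ℝ≥0) : ∑ i', startedOn i' (some (i, s)) = 1 := by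
  classical
  simp [startedOn, Finset.sum_ite_eq]

lemma sum_completion [Fintype M] (i : M) (s : ℝ≥0) (q : M → ℝ≥0∞) :
    ∑ i', (startOn i' (some (i, s)) + startedOn i' (some (i, s)) * q i') = s + q i := by
  classical
  simp [startedOn, startOn, Finset.sum_add_distrib, Finset.sum_ite_eq]

/-- Each machine processes at most one job at a time. -/
lemma sum_lintegral_busy_le {elig : M → Fin n → Prop} {p : M → Fin n → ℕ} {x : Observed M n}
    (hx : Consistent elig p x) (i : M) (β : ℝ → ℝ≥0∞) :
    ∑ j, ∫⁻ u in busy i (startData x j) (p i j), β u ≤ ∫⁻ u in Set.Ici (0 : ℝ), β u := by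
  have hd : Pairwise (Function.onFun Disjoint fun j => busy i (startData x j) (p i j)) := by
    intro j k hjk
    refine Set.disjoint_left.2 ?_
    rintro u ⟨s, hs, hu⟩ ⟨t, ht, hu'⟩
    rcases hx.disjoint j k i s t hjk hs ht with h | h
    · have h' : (s : ℝ) + p i j ≤ t := by exact_mod_cast h
      linarith [hu.2, hu'.1]
    · have h' : (t : ℝ) + p i k ≤ s := by exact_mod_cast h
      linarith [hu'.2, hu.1]
  rw [← tsum_fintype (L := .unconditional _),
    ← lintegral_iUnion (fun j => measurableSet_busy i _ _) hd]
  exact lintegral_mono_set (Set.iUnion_subset fun j => busy_subset i _ _)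

/-- Machine and start time of job `j` in outcome `ω`. -/
def start (μ : Measure Ω) (P : M → Fin n → Ω → ℕ) (π : Policy M n) (j : Fin n) (ω : Ω) :
    Option (M × ℝ≥0) :=
  startData (outcome μ P π ω) j

/-- With finitely many machines and jobs the realizations form a countable discrete space, on which
every function is measurable; policies need no regularity. -/
lemma measurable_of_realization [Finite M] {E : Type*} [MeasurableSpace E]
    (hmeas : ∀ i j, Measurable (P i j)) (Φ : (M → Fin n → ℕ) → E) :
    Measurable fun ω => Φ fun i j => P i j ω :=
  (Measurable.of_discrete (f := Φ)).comp
    (measurable_pi_lambda _ fun i => measurable_pi_lambda _ fun j => hmeas i j)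

/-- The start of a job is independent of its processing times. -/
lemma indepFun_start [Finite M] (hmeas : ∀ i j, Measurable (P i j))
    (hindep : iIndepFun (fun (j : Fin n) (ω : Ω) (i : M) => P i j ω) μ) (π : Policy M n)
    (i : M) (j : Fin n) (G : Option (M × ℝ≥0) → ℝ≥0∞) (H : ℕ → ℝ≥0∞) :
    ∫⁻ ω, G (start μ P π j ω) * H (P i j ω) ∂μ =
      (∫⁻ ω, G (start μ P π j ω) ∂μ) * ∫⁻ ω, H (P i j ω) ∂μ := by
  classical
  let S : Finset (Fin n) := Finset.univ.erase j
  -- The processing times of `j` are replaced by `0`. By non-anticipation its start is unchanged, so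
  -- it is a function of the other jobs' times alone.
  let F : (S → M → ℕ) → ℝ≥0∞ := fun r => G (startData (finalState (Eligible μ P) π
    fun i k => if h : k ∈ S then r ⟨k, h⟩ i else 0) j)
  have hF : ∀ ω, G (start μ P π j ω) = F fun k i => P i k ω := fun ω =>
    congrArg G (startData_finalState_congr (fun k hk i => by simp [S, hk]) _ π)
  have hind := hindep.indepFun_finset S {j} (by simp [S])
    fun k => measurable_pi_lambda _ fun i => hmeas i k
  have := hind.comp (φ := F) (ψ := fun r => H (r ⟨j, by simp⟩ i)) .of_discrete .of_discrete
  simp only [hF]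
  refine lintegral_mul_eq_lintegral_mul_lintegral_of_indepFun'' ?_ ?_ this
  · exact (measurable_of_realization hmeas fun p => F fun k i => p i k).aemeasurable
  · exact (measurable_of_realization hmeas fun p => H (p i j)).aemeasurable

/-- The second moment in terms of the squared coefficient of variation. -/
lemma lintegral_sq_le [IsProbabilityMeasure μ] (hmeas : ∀ i j, Measurable (P i j)) {i : M}
    {j : Fin n} (h0 : mean μ P i j ≠ 0) (h : Eligible μ P i j) :
    ∫⁻ ω, (P i j ω : ℝ≥0∞) ^ 2 ∂μ ≤ (1 + maxSqCV μ P) * mean μ P i j ^ 2 := by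
  have hm : Measurable fun ω => (P i j ω : ℝ) := Measurable.of_discrete.comp (hmeas i j)
  have hint : ENNReal.ofReal (μ[fun ω => (P i j ω : ℝ)]) = mean μ P i j := by
    rw [integral_eq_lintegral_of_nonneg_ae (ae_of_all _ fun ω => by simp) hm.aestronglyMeasurable]
    simp only [ENNReal.ofReal_natCast]
    exact ENNReal.ofReal_toReal h
  have h2 : ∫⁻ ω, (P i j ω : ℝ≥0∞) ^ 2 ∂μ ≤
      evariance (fun ω => (P i j ω : ℝ)) μ + mean μ P i j ^ 2 := by
    rw [evariance_def' hm.aestronglyMeasurable,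
      ENNReal.ofReal_pow (integral_nonneg fun ω => by simp), hint]
    -- The subtraction is truncated, and this inequality also covers an infinite second moment.
    refine le_trans (le_of_eq ?_) le_tsub_add
    refine lintegral_congr fun ω => ?_
    simp
  have h3 : evariance (fun ω => (P i j ω : ℝ)) μ ≤ maxSqCV μ P * mean μ P i j ^ 2 := by
    rw [← ENNReal.div_le_iff (pow_ne_zero 2 h0) (ENNReal.pow_ne_top h)]
    exact le_iSup_of_le i (le_iSup_of_le j (le_iSup_of_le h le_rfl))
  calc _ ≤ _ := h2
    _ ≤ maxSqCV μ P * mean μ P i j ^ 2 + mean μ P i j ^ 2 := by gcongr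
    _ = _ := by ring

end Policies

end StochSched

namespace StochSched

open MeasureTheory ProbabilityTheory

/-! ### Comparison with a feasible policy -/

section Competitive

variable {M : Type*} [Fintype M] {n : ℕ} {Ω : Type*} [MeasurableSpace Ω] {μ : Measure Ω}
  {P : M → Fin n → Ω → ℕ} {w : Fin n → ℝ≥0} {a : Fin n → M} {pos : M → Equiv.Perm (Fin n)}

lemma exists_start_of_feasible {M : Type*} {P : M → Fin n → Ω → ℕ} {π : Policy M n} (hπ : Feasible μ P π) :
    ∀ᵐ ω ∂μ, ∀ j, ∃ i s, start μ P π j ω = some (i, s) ∧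
      completionTime (outcome μ P π ω) j = s + P i j ω := by
  filter_upwards [hπ] with ω hω j
  obtain ⟨i, s, q, h⟩ := hω j
  obtain ⟨rfl, -⟩ := (consistent_finalState _ π _).finished j i s q h
  exact ⟨i, s, startData_of_finished h, by simp [completionTime, h]⟩

/-- Almost surely exactly one machine receives `j`. These probabilities spread the single number α_j
over the machines. -/
lemma sum_lintegral_startedOn [IsProbabilityMeasure μ] (hmeas : ∀ i j, Measurable (P i j))
    {π : Policy M n} (hπ : Feasible μ P π) (j : Fin n) :
    ∑ i, ∫⁻ ω, startedOn i (start μ P π j ω) ∂μ = 1 := by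
  have hA : ∀ i, Measurable fun ω => startedOn i (start μ P π j ω) := fun i =>
    measurable_of_realization hmeas fun p =>
      startedOn i (startData (finalState (Eligible μ P) π p) j)
  rw [← lintegral_finsetSum _ fun i _ => hA i, lintegral_congr_ae (g := fun _ => 1)]
  · simp
  · filter_upwards [exists_start_of_feasible hπ] with ω hω
    obtain ⟨i, s, h, -⟩ := hω j
    rw [h, sum_startedOn]

/-- The expected completion time is the expected start time plus the expected processing time. -/
lemma lintegral_completionTime (hmeas : ∀ i j, Measurable (P i j))
    (hindep : iIndepFun (fun (j : Fin n) (ω : Ω) (i : M) => P i j ω) μ)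
    {π : Policy M n} (hπ : Feasible μ P π) (j : Fin n) :
    ∫⁻ ω, completionTime (outcome μ P π ω) j ∂μ =
      ∑ i, (∫⁻ ω, startOn i (start μ P π j ω) ∂μ +
        (∫⁻ ω, startedOn i (start μ P π j ω) ∂μ) * mean μ P i j) := by
  have hS : ∀ i, Measurable fun ω => startOn i (start μ P π j ω) := fun i =>
    measurable_of_realization hmeas fun p =>
      startOn i (startData (finalState (Eligible μ P) π p) j)
  have hA : ∀ i, Measurable fun ω => startedOn i (start μ P π j ω) * (P i j ω : ℝ≥0∞) := fun i =>
    measurable_of_realization hmeas fun p =>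
      startedOn i (startData (finalState (Eligible μ P) π p) j) * (p i j : ℝ≥0∞)
  calc ∫⁻ ω, completionTime (outcome μ P π ω) j ∂μ
      = ∫⁻ ω, ∑ i, (startOn i (start μ P π j ω) +
          startedOn i (start μ P π j ω) * (P i j ω : ℝ≥0∞)) ∂μ := by
        refine lintegral_congr_ae ?_
        filter_upwards [exists_start_of_feasible hπ] with ω hω
        obtain ⟨i, s, h, h'⟩ := hω j
        rw [h, h', sum_completion]
    _ = _ := by
        have hSA : ∀ i, Measurable fun ω => startOn i (start μ P π j ω) +
            startedOn i (start μ P π j ω) * (P i j ω : ℝ≥0∞) := fun i => (hS i).add (hA i)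
        rw [lintegral_finsetSum _ fun i _ => hSA i]
        refine Finset.sum_congr rfl fun i _ => ?_
        rw [lintegral_add_left (hS i), indepFun_start hmeas hindep π i j _ (fun q => (q : ℝ≥0∞))]
        rfl

lemma policyCost_eq (hmeas : ∀ i j, Measurable (P i j)) (π : Policy M n) :
    policyCost μ P w π = ∑ j, w j * ∫⁻ ω, completionTime (outcome μ P π ω) j ∂μ := by
  have hC : ∀ j, Measurable fun ω => completionTime (outcome μ P π ω) j := fun j =>
    measurable_of_realization hmeas fun p =>
      completionTime (finalState (Eligible μ P) π p) j
  unfold policyCost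
  rw [lintegral_finsetSum _ fun j _ => (hC j).const_mul _]
  exact Finset.sum_congr rfl fun j _ => lintegral_const_mul _ (hC j)

/-- The expected value of the dual solution while `j` is processed on `i` by the policy `π`. -/
lemma lintegral_startedOn_mul_increase_le [IsProbabilityMeasure μ]
    (hmeas : ∀ i j, Measurable (P i j))
    (hindep : iIndepFun (fun (j : Fin n) (ω : Ω) (i : M) => P i j ω) μ)
    (hpos : ∀ i j, 0 < mean μ P i j) (ha : IsGreedy μ P w a) (π : Policy M n) (i : M)
    (j : Fin n) :
    (∫⁻ ω, startedOn i (start μ P π j ω) ∂μ) * increase μ P w a j (a j) ≤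
      (2 + maxSqCV μ P) * (w j * (∫⁻ ω, startOn i (start μ P π j ω) ∂μ +
        (∫⁻ ω, startedOn i (start μ P π j ω) ∂μ) * mean μ P i j)) +
      ∫⁻ ω, (∫⁻ u in busy i (start μ P π j ω) (P i j ω),
        openWeight μ P w a pos i (ENNReal.ofReal (2 * u))) ∂μ := by
  by_cases hel : Eligible μ P i j
  swap
  -- On an ineligible machine `j` is never started, so the left side vanishes.
  · have hne : ∀ ω s, start μ P π j ω ≠ some (i, s) := fun ω s h =>
      hel ((consistent_finalState (Eligible μ P) π _).eligible j i s h)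
    simp [startedOn_of_ne (hne _)]
  set m := mean μ P i j with hm
  set α := increase μ P w a j (a j) with hα
  set EA := ∫⁻ ω, startedOn i (start μ P π j ω) ∂μ with hEA
  set ES := ∫⁻ ω, startOn i (start μ P π j ω) ∂μ with hES
  set β : ℝ → ℝ≥0∞ := fun u => openWeight μ P w a pos i (ENNReal.ofReal (2 * u)) with hβ
  set EB := ∫⁻ ω, (∫⁻ u in busy i (start μ P π j ω) (P i j ω), β u) ∂μ with hEB
  have hβm : Measurable β := (measurable_openWeight i).comp (by fun_prop)
  have hm0 : m ≠ 0 := (hpos i j).ne'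
  have hbound : ∀ ω, startedOn i (start μ P π j ω) * (P i j ω : ℝ≥0∞) * α ≤
      w j * (2 * (startOn i (start μ P π j ω) * (P i j ω : ℝ≥0∞)) +
        startedOn i (start μ P π j ω) * (P i j ω : ℝ≥0∞) ^ 2) +
      w j * m * (startedOn i (start μ P π j ω) * (P i j ω : ℝ≥0∞)) +
      m * ∫⁻ u in busy i (start μ P π j ω) (P i j ω), β u := fun ω =>
    startedOn_mul_le hβm fun u =>
      ((ha j).2 i hel).trans (increase_le hpos (fun j => (ha j).1) hel _)
  have hAP : ∫⁻ ω, startedOn i (start μ P π j ω) * (P i j ω : ℝ≥0∞) ∂μ = EA * m :=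
    indepFun_start hmeas hindep π i j _ fun q => (q : ℝ≥0∞)
  have hSP : ∫⁻ ω, startOn i (start μ P π j ω) * (P i j ω : ℝ≥0∞) ∂μ = ES * m :=
    indepFun_start hmeas hindep π i j _ fun q => (q : ℝ≥0∞)
  have hAP2 : ∫⁻ ω, startedOn i (start μ P π j ω) * (P i j ω : ℝ≥0∞) ^ 2 ∂μ ≤
      EA * ((1 + maxSqCV μ P) * m ^ 2) := by
    rw [indepFun_start hmeas hindep π i j _ fun q => (q : ℝ≥0∞) ^ 2]
    exact mul_le_mul_right (lintegral_sq_le hmeas hm0 hel) _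
  let v : (M → Fin n → ℕ) → Option (M × ℝ≥0) := fun p =>
    startData (finalState (Eligible μ P) π p) j
  have mAP : Measurable fun ω => startedOn i (start μ P π j ω) * (P i j ω : ℝ≥0∞) :=
    measurable_of_realization hmeas fun p => startedOn i (v p) * (p i j : ℝ≥0∞)
  have mSP : Measurable fun ω => startOn i (start μ P π j ω) * (P i j ω : ℝ≥0∞) :=
    measurable_of_realization hmeas fun p => startOn i (v p) * (p i j : ℝ≥0∞)
  have mAP2 : Measurable fun ω => startedOn i (start μ P π j ω) * (P i j ω : ℝ≥0∞) ^ 2 :=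
    measurable_of_realization hmeas fun p => startedOn i (v p) * (p i j : ℝ≥0∞) ^ 2
  have mSP2 : Measurable fun ω => 2 * (startOn i (start μ P π j ω) * (P i j ω : ℝ≥0∞)) +
      startedOn i (start μ P π j ω) * (P i j ω : ℝ≥0∞) ^ 2 := (mSP.const_mul _).add mAP2
  have mB : Measurable fun ω => ∫⁻ u in busy i (start μ P π j ω) (P i j ω), β u :=
    measurable_of_realization hmeas fun p => ∫⁻ u in busy i (v p) (p i j), β u
  have key : EA * m * α ≤
      w j * (2 * (ES * m) + EA * ((1 + maxSqCV μ P) * m ^ 2)) + w j * m * (EA * m) + m * EB := by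
    calc EA * m * α
        = ∫⁻ ω, startedOn i (start μ P π j ω) * (P i j ω : ℝ≥0∞) * α ∂μ := by
          rw [lintegral_mul_const _ mAP, hAP]
      _ ≤ _ := lintegral_mono hbound
      _ = w j * (2 * (ES * m) +
            ∫⁻ ω, startedOn i (start μ P π j ω) * (P i j ω : ℝ≥0∞) ^ 2 ∂μ) +
          w j * m * (EA * m) + m * EB := by
          rw [lintegral_add_right _ (mB.const_mul _), lintegral_add_right _ (mAP.const_mul _),
            lintegral_const_mul _ mSP2, lintegral_add_right _ mAP2,
            lintegral_const_mul _ mSP, lintegral_const_mul _ mAP, lintegral_const_mul _ mB,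
            hAP, hSP]
      _ ≤ _ := by gcongr
  -- The factor 2 + Δ collects 1 + Δ from the second moment and 1 from the term `w j * m`.
  have key' : m * (EA * α) ≤
      m * (w j * (2 * ES + (2 + maxSqCV μ P) * (EA * m)) + EB) := by
    calc m * (EA * α) = EA * m * α := by ring
      _ ≤ _ := key
      _ = _ := by ring
  refine ((ENNReal.mul_le_mul_iff_right hm0 hel).1 key').trans ?_
  refine add_le_add_left ?_ _
  -- The start times only need the factor 2; raising it to 2 + Δ assembles completion times.
  calc (w j : ℝ≥0∞) * (2 * ES + (2 + maxSqCV μ P) * (EA * m))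
      ≤ w j * ((2 + maxSqCV μ P) * ES + (2 + maxSqCV μ P) * (EA * m)) := by
        gcongr
        exact le_self_add
    _ = _ := by ring

/-- Summing the per-pair estimate bounds ALG by 2 + Δ times the cost of the policy plus ALG/2;
finiteness of ALG allows the cancellation. -/
lemma listCost_le_policyCost [IsProbabilityMeasure μ] (hmeas : ∀ i j, Measurable (P i j))
    (hindep : iIndepFun (fun (j : Fin n) (ω : Ω) (i : M) => P i j ω) μ)
    (hpos : ∀ i j, 0 < mean μ P i j) (ha : IsGreedy μ P w a) (hp : IsWSEPT μ P w a pos)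
    {π : Policy M n} (hπ : Feasible μ P π) :
    listCost μ P w a pos ≤ (4 + 2 * maxSqCV μ P) * policyCost μ P w π := by
  have hael : ∀ j, Eligible μ P (a j) j := fun j => (ha j).1
  let β : M → ℝ → ℝ≥0∞ := fun i u => openWeight μ P w a pos i (ENNReal.ofReal (2 * u))
  let B : M → Fin n → Ω → ℝ≥0∞ := fun i j ω =>
    ∫⁻ u in busy i (start μ P π j ω) (P i j ω), β i u
  have mB : ∀ i j, Measurable (B i j) := fun i j =>
    measurable_of_realization hmeas fun p =>
      ∫⁻ u in busy i (startData (finalState (Eligible μ P) π p) j) (p i j), β i u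
  have hB : ∑ j, ∑ i, ∫⁻ ω, B i j ω ∂μ ≤ listCost μ P w a pos / 2 := by
    calc ∑ j, ∑ i, ∫⁻ ω, B i j ω ∂μ = ∫⁻ ω, ∑ i, ∑ j, B i j ω ∂μ := by
          rw [Finset.sum_comm, lintegral_finsetSum _ fun i _ => Finset.measurable_sum _ fun j _ =>
            mB i j]
          exact Finset.sum_congr rfl fun i _ => (lintegral_finsetSum _ fun j _ => mB i j).symm
      _ ≤ ∫⁻ _, ∑ i, (∫⁻ u in Set.Ici (0 : ℝ), β i u) ∂μ :=
          lintegral_mono fun ω => Finset.sum_le_sum fun i _ =>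
            sum_lintegral_busy_le (consistent_finalState (Eligible μ P) π fun i j => P i j ω) i (β i)
      _ = ∑ i, ∫⁻ u in Set.Ici (0 : ℝ), β i u := by simp
      _ ≤ _ := by
          rw [listCost_eq hmeas]
          exact lintegral_openWeight_le hael
  have hj : ∀ j, increase μ P w a j (a j) ≤
      (2 + maxSqCV μ P) * (w j * ∫⁻ ω, completionTime (outcome μ P π ω) j ∂μ) +
        ∑ i, ∫⁻ ω, B i j ω ∂μ := by
    intro j
    rw [lintegral_completionTime hmeas hindep hπ, ← one_mul (increase μ P w a j (a j)),
      ← sum_lintegral_startedOn hmeas hπ j, Finset.sum_mul, Finset.mul_sum, Finset.mul_sum,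
      ← Finset.sum_add_distrib]
    exact Finset.sum_le_sum fun i _ =>
      lintegral_startedOn_mul_increase_le hmeas hindep hpos ha π i j
  have hle : listCost μ P w a pos ≤
      (2 + maxSqCV μ P) * policyCost μ P w π + listCost μ P w a pos / 2 := by
    calc listCost μ P w a pos ≤ ∑ j, increase μ P w a j (a j) := by
          rw [listCost_eq hmeas]
          exact sum_weight_mul_expCompletion_le hpos hael hp
      _ ≤ ∑ j, ((2 + maxSqCV μ P) * (w j * ∫⁻ ω, completionTime (outcome μ P π ω) j ∂μ) +
            ∑ i, ∫⁻ ω, B i j ω ∂μ) := Finset.sum_le_sum fun j _ => hj j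
      _ = (2 + maxSqCV μ P) * policyCost μ P w π + ∑ j, ∑ i, ∫⁻ ω, B i j ω ∂μ := by
          rw [Finset.sum_add_distrib, ← Finset.mul_sum, policyCost_eq hmeas]
      _ ≤ _ := by gcongr
  have hhalf : listCost μ P w a pos / 2 ≠ ⊤ :=
    ENNReal.div_ne_top (listCost_ne_top hmeas hael) two_ne_zero
  have h2 : listCost μ P w a pos / 2 ≤ (2 + maxSqCV μ P) * policyCost μ P w π := by
    refine (ENNReal.add_le_add_iff_right hhalf).1 ?_
    rwa [ENNReal.add_halves]
  calc listCost μ P w a pos = 2 * (listCost μ P w a pos / 2) := by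
        rw [two_mul, ENNReal.add_halves]
    _ ≤ 2 * ((2 + maxSqCV μ P) * policyCost μ P w π) := by gcongr
    _ = _ := by ring

/-- A job of positive weight costs every policy at least its smallest expected processing time. -/
lemma weight_mul_iInf_mean_le_optCost [IsProbabilityMeasure μ] (hmeas : ∀ i j, Measurable (P i j))
    (hindep : iIndepFun (fun (j : Fin n) (ω : Ω) (i : M) => P i j ω) μ) (j : Fin n) :
    w j * ⨅ i, mean μ P i j ≤ optCost μ P w := by
  refine le_iInf₂ fun π hπ => ?_
  rw [policyCost_eq hmeas]
  refine le_trans (mul_le_mul_right ?_ _) (Finset.single_le_sum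
    (f := fun j => (w j : ℝ≥0∞) * ∫⁻ ω, completionTime (outcome μ P π ω) j ∂μ)
    (fun _ _ => zero_le) (Finset.mem_univ j))
  rw [lintegral_completionTime hmeas hindep hπ, ← one_mul (⨅ i, mean μ P i j),
    ← sum_lintegral_startedOn hmeas hπ j, Finset.sum_mul]
  refine Finset.sum_le_sum fun i _ => le_trans ?_ le_add_self
  exact mul_le_mul_right (iInf_le _ i) _

/-- Needed only for Δ = `⊤`: since `⊤ * 0 = 0`, the bound is trivial there only if the optimum is
nonzero. -/
lemma optCost_ne_zero [IsProbabilityMeasure μ] (hmeas : ∀ i j, Measurable (P i j))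
    (hindep : iIndepFun (fun (j : Fin n) (ω : Ω) (i : M) => P i j ω) μ)
    (hpos : ∀ i j, 0 < mean μ P i j) {j : Fin n} (hj : w j ≠ 0) (i : M) :
    optCost μ P w ≠ 0 := by
  have : Nonempty M := ⟨i⟩
  obtain ⟨i₀, h⟩ := exists_eq_ciInf_of_finite (f := fun i => mean μ P i j)
  have : 0 < w j * ⨅ i, mean μ P i j :=
    ENNReal.mul_pos (by simpa using hj) (h ▸ (hpos i₀ j).ne')
  exact (this.trans_le (weight_mul_iInf_mean_le_optCost hmeas hindep j)).ne'

end Competitive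

end StochSched

end

theorem mainTheorem1 {M : Type*} [Fintype M] (n : ℕ)
    {Ω : Type*} [MeasurableSpace Ω] (μ : MeasureTheory.Measure Ω)
    [MeasureTheory.IsProbabilityMeasure μ]
    (P : M → Fin n → Ω → ℕ) (w : Fin n → ℝ≥0)
    (hmeas : ∀ i j, Measurable (P i j))
    (hindep : ProbabilityTheory.iIndepFun (fun (j : Fin n) (ω : Ω) (i : M) => P i j ω) μ)
    (hpos : ∀ i j, 0 < StochSched.mean μ P i j)
    (helig : ∀ j, ∃ i, StochSched.Eligible μ P i j) :
    (∃ (a : Fin n → M) (pos : M → Equiv.Perm (Fin n)),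
      StochSched.IsGreedy μ P w a ∧ StochSched.IsWSEPT μ P w a pos) ∧
    ∀ (a : Fin n → M) (pos : M → Equiv.Perm (Fin n)),
      StochSched.IsGreedy μ P w a → StochSched.IsWSEPT μ P w a pos →
        StochSched.listCost μ P w a pos ≤
          (4 + 2 * StochSched.maxSqCV μ P) * StochSched.optCost μ P w := by
  constructor
  · obtain ⟨a, ha⟩ := StochSched.exists_isGreedy helig w
    obtain ⟨pos, hp⟩ := StochSched.exists_isWSEPT μ P w a
    exact ⟨a, pos, ha, hp⟩
  intro a pos ha hp
  by_cases hw : ∀ j, w j = 0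
  · rw [StochSched.listCost_eq hmeas]
    simp [hw]
  obtain ⟨j, hj⟩ := not_forall.1 hw
  have hopt : StochSched.optCost μ P w ≠ 0 :=
    StochSched.optCost_ne_zero hmeas hindep hpos hj (a j)
  by_cases hΔ : StochSched.maxSqCV μ P = ⊤
  · simp [hΔ, ENNReal.top_mul hopt]
  have hc : 4 + 2 * StochSched.maxSqCV μ P ≠ ⊤ := by finiteness
  have hc0 : 4 + 2 * StochSched.maxSqCV μ P ≠ 0 := by simp
  -- The finite nonzero factor is moved to the left so that the infimum over policies can be bounded
  -- policy by policy.
  rw [mul_comm, ← ENNReal.div_le_iff hc0 hc]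
  refine le_iInf₂ fun π hπ => ?_
  rw [ENNReal.div_le_iff hc0 hc, mul_comm]
  exact StochSched.listCost_le_policyCost hmeas hindep hpos ha hp hπ
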